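/- For Heyting algebras $B$, $C$ let $B + C$ denote their concatenation: $C$ is put on top of $B$, and the top element of $B$ is glued to the bottom element of $C$; here $B\times C + D$ means $(B\times C)+D$. Let $Z$ be the Rieger–Nishimura ladder (the free Heyting algebra on one generator $g$), let $Z_2=\{0,1\}$ be the two-element Boolean algebra, and let $Z' = Z\times Z_2 + Z_2$. For a class $V$ of Heyting algebras, a formula $\varphi(p_1,\dots,p_n)$ in the connectives $\wedge,\vee,\to,\neg$ and elements $a_1,\dots,a_n$ of a Heyting algebra $B$ are said to define $B$ over $V$ if (1) $a_1,\dots,a_n$ generate $B$, (2) $\varphi(a_1,\dots,a_n)=1$ in $B$, and (3) for every formula $\psi(p_1,\dots,p_n)$ with $\psi(a_1,\dots,a_n)=1$ in $B$, the formula $\varphi\to\psi$ is valid in every algebra of $V$. The algebra $B$ is finitely presentable over $V$ if some formula and some finite tuple of elements define it over $V$. **Theorem.** Let $A$ be any non-degenerate Heyting algebra and let $V$ be the variety generated by $Z\times Z_2 + A$. The algebra $Z'$ is infinite and subdirectly irreducible, it belongs to $V$, and it is finitely presentable over $V$. More precisely, the formula $$\neg(p\wedge q)\wedge(\neg\neg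 q\to q)\wedge\bigl(p^{10}\to(q\vee\neg q)\bigr),\qquad p^{10}=(\neg\neg p\to p)\vee\bigl((\neg\neg p\to p)\to(p\vee\neg p)\bigr),$$ together with the valuation $p\mapsto (g,0)$, $q\mapsto(0,1)$ in $Z\times Z_2\subseteq Z'$, defines $Z'$ over $V$. -/

import Mathlib

universe u v

/-! ### Propositional formulas and their values in Heyting algebras -/

/-- Propositional formulas in the signature `∧, ∨, →, ¬` over a set `σ` of variables. -/
inductive Formula (σ : Type) : Type
  | var : σ → Formula σ
  | and : Formula σ → Formula σ → Formula σ
  | or : Formula σ → Formula σ → Formula σ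
  | imp : Formula σ → Formula σ → Formula σ
  | neg : Formula σ → Formula σ

/-- The value of a formula under a valuation of its variables. -/
def Formula.eval {σ : Type} {A : Type u} [HeytingAlgebra A] (ν : σ → A) : Formula σ → A
  | .var i => ν i
  | .and φ ψ => φ.eval ν ⊓ ψ.eval ν
  | .or φ ψ => φ.eval ν ⊔ ψ.eval ν
  | .imp φ ψ => φ.eval ν ⇨ ψ.eval ν
  | .neg φ => (φ.eval ν)ᶜ

/-! ### Varieties -/

/-- A class of Heyting algebras (with carriers in a fixed universe). -/
abbrev HeytingClass : Type (u + 1) := ∀ (A : Type u) [HeytingAlgebra A], Prop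

/-- A variety: a class closed under homomorphic images, (isomorphic copies of) subalgebras and
direct products. -/
structure IsVariety (K : HeytingClass.{u}) : Prop where
  homImage : ∀ (A B : Type u) [HeytingAlgebra A] [HeytingAlgebra B] (f : HeytingHom A B),
    Function.Surjective f → K A → K B
  subalgebra : ∀ (A B : Type u) [HeytingAlgebra A] [HeytingAlgebra B] (f : HeytingHom B A),
    Function.Injective f → K A → K B
  product : ∀ (I : Type u) (A : I → Type u) [∀ i, HeytingAlgebra (A i)],
    (∀ i, K (A i)) → K (∀ i, A i)

/-- The variety generated by `A`: the smallest variety that contains `A`. -/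
def generatedVariety (A : Type u) [HeytingAlgebra A] : HeytingClass.{u} :=
  fun B _ => ∀ K : HeytingClass.{u}, IsVariety K → K A → K B

/-- The formula `φ` is valid in every algebra of the class `K`. -/
def ValidIn {σ : Type} (K : HeytingClass.{u}) (φ : Formula σ) : Prop :=
  ∀ (C : Type u) [HeytingAlgebra C], K C → ∀ μ : σ → C, φ.eval μ = ⊤

/-! ### Finite presentability -/

/-- The elements `ν i` generate `A`: the only subset that contains them and is closed under the
operations is `A` itself. -/
def Generates {σ : Type} {A : Type u} [HeytingAlgebra A] (ν : σ → A) : Prop :=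
  ∀ S : Set A, (∀ i, ν i ∈ S) →
    (∀ x ∈ S, ∀ y ∈ S, x ⊓ y ∈ S) → (∀ x ∈ S, ∀ y ∈ S, x ⊔ y ∈ S) →
    (∀ x ∈ S, ∀ y ∈ S, x ⇨ y ∈ S) → (∀ x ∈ S, xᶜ ∈ S) → S = Set.univ

/-- The formula `φ` and the valuation `ν` define the algebra `A` over the class `K`. -/
structure DefinesOver {n : ℕ} (K : HeytingClass.{u}) {A : Type v} [HeytingAlgebra A]
    (φ : Formula (Fin n)) (ν : Fin n → A) : Prop where
  generates : Generates ν
  holds : φ.eval ν = ⊤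
  consequence : ∀ ψ : Formula (Fin n), ψ.eval ν = ⊤ → ValidIn K (.imp φ ψ)

/-- The algebra `A` is finitely presentable over the class `K`. -/
def FinitelyPresentableOver (K : HeytingClass.{u}) (A : Type v) [HeytingAlgebra A] : Prop :=
  ∃ (n : ℕ) (φ : Formula (Fin n)) (ν : Fin n → A), DefinesOver K φ ν

/-- The class `K` contains an isomorphic copy of `A`. (An order isomorphism of Heyting algebras
preserves all the operations; the copy only serves to move `A` to the universe of `K`.) -/
def ContainsCopy (K : HeytingClass.{u}) (A : Type v) [HeytingAlgebra A] : Prop :=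
  ∃ (C : Type u) (_ : HeytingAlgebra C), K C ∧ Nonempty (A ≃o C)

/-! ### Subdirect irreducibility -/

/-- Congruences of a Heyting algebra. -/
structure IsHeytingCongruence {A : Type u} [HeytingAlgebra A] (r : Setoid A) : Prop where
  inf : ∀ a b c d, r a b → r c d → r (a ⊓ c) (b ⊓ d)
  sup : ∀ a b c d, r a b → r c d → r (a ⊔ c) (b ⊔ d)
  himp : ∀ a b c d, r a b → r c d → r (a ⇨ c) (b ⇨ d)
  compl : ∀ a b, r a b → r aᶜ bᶜ

/-- `A` is subdirectly irreducible: it is non-degenerate, and among its congruences other than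
equality there is a least one. -/
def SubdirectlyIrreducible (A : Type u) [HeytingAlgebra A] : Prop :=
  Nontrivial A ∧ ∃ r : Setoid A, IsHeytingCongruence r ∧ r ≠ ⊥ ∧
    ∀ s : Setoid A, IsHeytingCongruence s → s ≠ ⊥ → r ≤ s

/-! ### The Rieger–Nishimura ladder -/

/-- The points `w₀, w₁, w₂, …` of the Rieger–Nishimura frame. -/
@[ext] structure RNPoint : Type where
  idx : ℕ

/-- `wₘ ≤ wₙ` (in the frame: `wₙ` sees `wₘ`) if and only if `m = n` or `m + 2 ≤ n`. So `w₀` and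
`w₁` see only themselves, `w₂` sees `w₀`, `w₃` sees `w₀, w₁`, `w₄` sees `w₀, w₁, w₂`, etc. -/
instance : PartialOrder RNPoint where
  le w w' := w.idx = w'.idx ∨ w.idx + 2 ≤ w'.idx
  le_refl w := Or.inl rfl
  le_trans a b c := by intro h h'; omega
  le_antisymm a b h h' := by
    apply RNPoint.ext; omega

/-- The Rieger–Nishimura ladder, as the Heyting algebra of all sets of points of the
Rieger–Nishimura frame that are closed under the relation `sees`. They are
`∅, {w₀}, {w₁}, {w₀, w₁}, {w₀, w₂}, {w₀, w₁, w₂}, {w₀, w₁, w₃}, …` and the whole frame. -/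
abbrev RNLadder : Type := LowerSet RNPoint

/-- The free generator `g = {w₀}` of the Rieger–Nishimura ladder. -/
def RNLadder.gen : RNLadder := LowerSet.Iic ⟨0⟩

/-! ### Concatenation -/

/-- The concatenation `A + B`: the algebra `B` is put onto `A`, and the top of `A` is glued to the
bottom of `B`. An element `a` of `A` is represented by the pair `(a, ⊥)`, an element `b` of `B` by
the pair `(⊤, b)`; the glued element is `(⊤, ⊥)`. -/
@[ext] structure Concat (A : Type u) (B : Type v) [HeytingAlgebra A] [HeytingAlgebra B] :
    Type (max u v) where
  fst : A
  snd : B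
  glued : fst = ⊤ ∨ snd = ⊥

namespace Concat

variable {A : Type u} {B : Type v} [HeytingAlgebra A] [HeytingAlgebra B]

/-- The copy of `A` in `A + B`. -/
def inl (a : A) : Concat A B := ⟨a, ⊥, Or.inr rfl⟩

/-- The copy of `B` in `A + B`. -/
def inr (b : B) : Concat A B := ⟨⊤, b, Or.inl rfl⟩

/-- Each copy has its own order, and every element of `A` is below every element of `B`. -/
instance : PartialOrder (Concat A B) where
  le x y := x.fst ≤ y.fst ∧ x.snd ≤ y.snd
  le_refl x := ⟨le_rfl, le_rfl⟩
  le_trans x y z h h' := ⟨h.1.trans h'.1, h.2.trans h'.2⟩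
  le_antisymm x y h h' := Concat.ext (h.1.antisymm h'.1) (h.2.antisymm h'.2)

instance : DistribLattice (Concat A B) where
  sup x y := ⟨x.fst ⊔ y.fst, x.snd ⊔ y.snd, by
    rcases x.glued with h | h <;> rcases y.glued with h' | h' <;> simp [h, h']⟩
  le_sup_left x y := ⟨le_sup_left, le_sup_left⟩
  le_sup_right x y := ⟨le_sup_right, le_sup_right⟩
  sup_le x y z h h' := ⟨sup_le h.1 h'.1, sup_le h.2 h'.2⟩
  inf x y := ⟨x.fst ⊓ y.fst, x.snd ⊓ y.snd, by
    rcases x.glued with h | h <;> rcases y.glued with h' | h' <;> simp [h, h']⟩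
  inf_le_left x y := ⟨inf_le_left, inf_le_left⟩
  inf_le_right x y := ⟨inf_le_right, inf_le_right⟩
  le_inf x y z h h' := ⟨le_inf h.1 h'.1, le_inf h.2 h'.2⟩
  le_sup_inf x y z := ⟨le_sup_inf, le_sup_inf⟩

instance : BoundedOrder (Concat A B) where
  top := ⟨⊤, ⊤, Or.inl rfl⟩
  le_top _ := ⟨le_top, le_top⟩
  bot := ⟨⊥, ⊥, Or.inr rfl⟩
  bot_le _ := ⟨bot_le, bot_le⟩

open Classical in
/-- The Heyting implication of `A + B`. -/
noncomputable def himp (x y : Concat A B) : Concat A B where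
  fst := x.fst ⇨ y.fst
  snd := if x.fst ≤ y.fst then x.snd ⇨ y.snd else ⊥
  glued := by
    by_cases h : x.fst ≤ y.fst
    · exact Or.inl (himp_eq_top_iff.2 h)
    · exact Or.inr (if_neg h)

open Classical in
theorem le_himp (x y z : Concat A B) : x ≤ himp y z ↔ x ⊓ y ≤ z := by
  change (x.fst ≤ y.fst ⇨ z.fst ∧ x.snd ≤ if y.fst ≤ z.fst then _ else _) ↔
    (x.fst ⊓ y.fst ≤ z.fst ∧ x.snd ⊓ y.snd ≤ z.snd)
  by_cases h : y.fst ≤ z.fst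
  · rw [if_pos h, le_himp_iff, le_himp_iff]
  · rw [if_neg h, le_himp_iff]
    refine and_congr_right fun h1 => ⟨fun h2 => (inf_le_left.trans h2).trans bot_le, fun _ => ?_⟩
    rcases x.glued with hx | hx
    · rw [hx, top_inf_eq] at h1
      exact absurd h1 h
    · exact hx.le

noncomputable instance : HeytingAlgebra (Concat A B) :=
  HeytingAlgebra.ofHImp himp le_himp

end Concat

/-! ### The algebra `Z' = Z × Z₂ + Z₂` and its presentation -/

/-- The algebra `Z' = Z × Z₂ + Z₂`, where `Z` is the Rieger–Nishimura ladder. -/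
abbrev ZPrime : Type := Concat (RNLadder × Bool) Bool

/-- The element `(g, 0)` of `Z'`. -/
noncomputable def ZPrime.a : ZPrime := Concat.inl (RNLadder.gen, false)

/-- The element `(0, 1)` of `Z'`. -/
noncomputable def ZPrime.b : ZPrime := Concat.inl (⊥, true)

/-- For a formula `p`, the formula `p¹⁰ = (¬¬p → p) ∨ ((¬¬p → p) → (p ∨ ¬p))`. -/
def Formula.pow10 {σ : Type} (p : Formula σ) : Formula σ :=
  .or (.imp (.neg (.neg p)) p) (.imp (.imp (.neg (.neg p)) p) (.or p (.neg p)))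

/-- The formula `¬(p ∧ q) ∧ (¬¬q → q) ∧ (p¹⁰ → (q ∨ ¬q))` in the variables `p = p₀`, `q = p₁`. -/
def definingFormula : Formula (Fin 2) :=
  let p : Formula (Fin 2) := .var 0
  let q : Formula (Fin 2) := .var 1
  .and (.neg (.and p q))
    (.and (.imp (.neg (.neg q)) q) (.imp p.pow10 (.or q (.neg q))))

/-!
Let `e` be the value of the defining formula at a pair `(p, q)` in `Z × Z₂ + A`. If `e ≤ q ∨ ¬q`,
then `e` splits into `e ∧ q`, below which `(p, q)` agrees with `(0, 1)`, and `e ∧ ¬q`, below which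
it agrees with `(p, 0)`. Both pairs are homomorphic images of the generators of `Z'`: project to
`Z₂`, or project to `Z`, which is free on `g`. So `e` lies below every formula that holds in `Z'`.

The inequality fails only at `p = (g, 0)`, `q = (0, 1)`, where the pair is the image of the
generators of `Z'` under the embedding of `Z × Z₂ + Z₂`. Indeed, `p¹⁰ = 1` gives `e ≤ q ∨ ¬q` at
once, and in `Z` only `g` is neither regular nor dense, so `p` has first coordinate `g`. The
inequality holds throughout `Z × Z₂`, hence `e` and `q ∨ ¬q` are both sent to `1` there; as `1` is
join-prime in `Z` and `p ∧ q` vanishes, `q` has first coordinate `0`.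

The freeness of `Z` is read off from the Nishimura terms `d₀, d₁, d₂, …`, which represent the
principal elements of `Z`: the terms with `m + 2 ≤ n` satisfy `dₘ ≤ dₙ`, and `dₙ ∧ dₙ₊₁` lies below
every common upper bound of the `dₖ` with `k + 2 ≤ n`.
-/

/-! ### Formulas, congruences and varieties -/

theorem Formula.eval_comp {σ : Type} {A : Type u} {B : Type v} [HeytingAlgebra A]
    [HeytingAlgebra B] (f : HeytingHom A B) (ν : σ → A) (χ : Formula σ) :
    χ.eval (f ∘ ν) = f (χ.eval ν) := by
  induction χ <;> simp_all only [Formula.eval, Function.comp_apply, map_inf, map_sup, map_himp,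
    map_compl]

theorem Formula.eval_comp_pair {A : Type u} {B : Type v} [HeytingAlgebra A]
    [HeytingAlgebra B] (f : HeytingHom A B) (x y : A) (χ : Formula (Fin 2)) :
    χ.eval ![f x, f y] = f (χ.eval ![x, y]) := by
  rw [← χ.eval_comp f, ← FinVec.map_eq]
  rfl

theorem IsHeytingCongruence.eval {σ : Type} {A : Type u} [HeytingAlgebra A] {r : Setoid A}
    (hr : IsHeytingCongruence r) {ν μ : σ → A} (h : ∀ i, r (ν i) (μ i)) (χ : Formula σ) :
    r (χ.eval ν) (χ.eval μ) := by
  induction χ with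
  | var i => exact h i
  | and φ ψ hφ hψ => exact hr.inf _ _ _ _ hφ hψ
  | or φ ψ hφ hψ => exact hr.sup _ _ _ _ hφ hψ
  | imp φ ψ hφ hψ => exact hr.himp _ _ _ _ hφ hψ
  | neg φ hφ => exact hr.compl _ _ hφ

theorem inf_himp_inf_inf {A : Type u} [HeytingAlgebra A] (c x y : A) :
    c ⊓ ((c ⊓ x) ⇨ (c ⊓ y)) = c ⊓ (x ⇨ y) := by
  refine le_antisymm (le_inf inf_le_left (le_himp_iff.2 ?_)) (le_inf inf_le_left (le_himp_iff.2 ?_))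
  · calc c ⊓ ((c ⊓ x) ⇨ (c ⊓ y)) ⊓ x = (c ⊓ x) ⊓ ((c ⊓ x) ⇨ (c ⊓ y)) := inf_right_comm _ _ _
      _ ≤ y := inf_himp_le.trans inf_le_right
  · calc c ⊓ (x ⇨ y) ⊓ (c ⊓ x) = c ⊓ (x ⊓ (x ⇨ y)) := by rw [← inf_inf_distrib_left, inf_comm x]
      _ ≤ c ⊓ y := inf_le_inf_left c inf_himp_le

theorem isHeytingCongruence_ker_inf {A : Type u} [HeytingAlgebra A] (c : A) :
    IsHeytingCongruence (Setoid.ker (c ⊓ ·)) := by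
  have himp : ∀ x y z w : A, c ⊓ x = c ⊓ y → c ⊓ z = c ⊓ w → c ⊓ (x ⇨ z) = c ⊓ (y ⇨ w) :=
    fun x y z w h h' => by rw [← inf_himp_inf_inf, h, h', inf_himp_inf_inf]
  constructor <;> intro x y
  · intro z w (h : c ⊓ x = c ⊓ y) (h' : c ⊓ z = c ⊓ w)
    change c ⊓ (x ⊓ z) = c ⊓ (y ⊓ w)
    rw [inf_inf_distrib_left, h, h', ← inf_inf_distrib_left]
  · intro z w (h : c ⊓ x = c ⊓ y) (h' : c ⊓ z = c ⊓ w)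
    change c ⊓ (x ⊔ z) = c ⊓ (y ⊔ w)
    rw [inf_sup_left, h, h', ← inf_sup_left]
  · exact himp x y
  · intro h
    change c ⊓ xᶜ = c ⊓ yᶜ
    rw [← himp_bot, ← himp_bot, himp x y ⊥ ⊥ h rfl]

theorem le_eval_of_forall_inf_eq {σ : Type} {A : Type u} [HeytingAlgebra A] {c : A} {ν μ : σ → A}
    {χ : Formula σ} (h : ∀ i, c ⊓ ν i = c ⊓ μ i) (hμ : χ.eval μ = ⊤) : c ≤ χ.eval ν := by
  have : c ⊓ χ.eval ν = c ⊓ χ.eval μ := (isHeytingCongruence_ker_inf c).eval h χ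
  rwa [hμ, inf_top_eq, inf_eq_left] at this

theorem subdirectlyIrreducible_of_isGreatest {A : Type u} [HeytingAlgebra A] {c : A}
    (hc : IsGreatest {x | x ≠ ⊤} c) : SubdirectlyIrreducible A := by
  refine ⟨⟨c, ⊤, hc.1⟩, Setoid.ker (c ⊓ ·), isHeytingCongruence_ker_inf c, fun h => ?_,
    fun s hs hne => ?_⟩
  · have hker : Setoid.ker (c ⊓ ·) c ⊤ := by simp [Setoid.ker_def]
    rw [h] at hker
    exact hc.1 hker
  · obtain ⟨x, y, hxy, hle⟩ : ∃ x y, s x y ∧ ¬ x ≤ y := by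
      by_contra! h
      exact hne (Setoid.ext fun x y => ⟨fun hxy => (h x y hxy).antisymm (h y x (s.symm hxy)),
        fun hxy : x = y => hxy ▸ s.refl x⟩)
    have himp : s (x ⇨ y) ⊤ := himp_self (a := y) ▸ hs.himp _ _ _ _ hxy (s.refl y)
    have himp_le : x ⇨ y ≤ c := hc.2 fun h => hle (himp_eq_top_iff.1 h)
    have hct : s c ⊤ := by
      simpa only [sup_eq_right.2 himp_le, top_sup_eq] using hs.sup _ _ _ _ himp (s.refl c)
    have hinf (z : A) : s (c ⊓ z) z := by
      simpa only [top_inf_eq] using hs.inf _ _ _ _ hct (s.refl z)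
    intro z w (hzw : c ⊓ z = c ⊓ w)
    exact s.trans (s.symm (hinf z)) (hzw ▸ hinf w)

theorem isVariety_eval_eq_top {σ : Type} (χ : Formula σ) :
    IsVariety.{u} fun A _ => ∀ μ : σ → A, χ.eval μ = ⊤ where
  homImage A B _ _ f hf h μ := by
    obtain ⟨ν, rfl⟩ := hf.comp_left μ
    rw [χ.eval_comp f, h, map_top]
  subalgebra A B _ _ f hf h μ := hf <| by rw [← χ.eval_comp f, h, map_top]
  product I A _ h μ := by
    funext i
    let proj : HeytingHom (∀ i, A i) (A i) :=
      { toFun := fun x => x i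
        map_sup' := fun _ _ => rfl
        map_inf' := fun _ _ => rfl
        map_bot' := rfl
        map_himp' := fun _ _ => rfl }
    exact (χ.eval_comp proj μ).symm.trans (h i _)

theorem validIn_generatedVariety {σ : Type} {A : Type u} [HeytingAlgebra A] {χ : Formula σ}
    (h : ∀ μ : σ → A, χ.eval μ = ⊤) : ValidIn (generatedVariety A) χ :=
  fun _ _ hC => hC _ (isVariety_eval_eq_top χ) h

theorem containsCopy_generatedVariety {A : Type u} {B : Type v} [HeytingAlgebra A]
    [HeytingAlgebra B] (f : HeytingHom B A) (hf : Function.Injective f) :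
    ContainsCopy (generatedVariety A) B := by
  have := small_of_injective hf
  let e := (equivShrink.{u} B).symm
  let := e.heytingAlgebra
  let i : Shrink.{u} B ≃o B := ⟨e, Iff.rfl⟩
  exact ⟨Shrink.{u} B, inferInstance, fun K hK hA =>
    hK.subalgebra A _ (f.comp i) (hf.comp i.injective) hA, ⟨i.symm⟩⟩


/-! ### Nishimura terms -/

/-- The values of the Nishimura terms at `x`. At the generator of the Rieger–Nishimura ladder the
`n`-th one is the principal lower set `Iic wₙ`: the recursion computes `Iic wₙ₊₁` as the
pseudocomplement of `wₙ` relative to the points `wₖ` strictly below `wₙ`. -/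
def nishimura {H : Type u} [HeytingAlgebra H] (x : H) : ℕ → H
  | 0 => x
  | n + 1 => nishimura x n ⇨ (Finset.univ : Finset (Fin (n - 1))).sup fun k => nishimura x k
  termination_by n => n
  decreasing_by all_goals omega

section nishimura

variable {H : Type u} [HeytingAlgebra H] {x a : H} {m n : ℕ}

theorem nishimura_zero : nishimura x 0 = x := by rw [nishimura]

theorem le_nishimura_succ_iff :
    a ≤ nishimura x (n + 1) ↔
      a ⊓ nishimura x n ≤ (Finset.univ : Finset (Fin (n - 1))).sup fun k => nishimura x k := by
  rw [nishimura, le_himp_iff]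

theorem nishimura_inf_succ_le (h : ∀ k, k + 2 ≤ n → nishimura x k ≤ a) :
    nishimura x n ⊓ nishimura x (n + 1) ≤ a := by
  rw [inf_comm]
  exact (le_nishimura_succ_iff.1 le_rfl).trans (Finset.sup_le fun k _ => h k (by omega))

theorem nishimura_mono (h : m + 2 ≤ n) : nishimura x m ≤ nishimura x n := by
  obtain ⟨n, rfl⟩ := Nat.exists_eq_add_of_le' (show 1 ≤ n by omega)
  rw [le_nishimura_succ_iff]
  obtain rfl | h : n = m + 1 ∨ m + 2 ≤ n := by omega
  · refine nishimura_inf_succ_le fun k hk => ?_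
    exact Finset.le_sup (f := fun k : Fin (m + 1 - 1) => nishimura x k)
      (Finset.mem_univ ⟨k, by omega⟩)
  · exact inf_le_left.trans (Finset.le_sup (f := fun k : Fin (n - 1) => nishimura x k)
      (Finset.mem_univ ⟨m, by omega⟩))

end nishimura

/-! ### The Rieger–Nishimura ladder is free on its generator -/

theorem RNPoint.le_iff {v w : RNPoint} : v ≤ w ↔ v.idx = w.idx ∨ v.idx + 2 ≤ w.idx := Iff.rfl

theorem RNPoint.isMin_zero : IsMin (⟨0⟩ : RNPoint) := fun w hw => by
  simp only [RNPoint.le_iff] at hw ⊢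
  omega

theorem RNPoint.isMin_one : IsMin (⟨1⟩ : RNPoint) := fun w hw => by
  simp only [RNPoint.le_iff] at hw ⊢
  omega

instance : Infinite RNPoint := .of_injective RNPoint.mk fun _ _ h => congrArg RNPoint.idx h

theorem nishimura_idx_mono {H : Type u} [HeytingAlgebra H] (x : H) :
    Monotone fun w : RNPoint => nishimura x w.idx := by
  rintro v w (h | h)
  · exact (congrArg (nishimura x) h).le
  · exact nishimura_mono h

namespace RNLadder

theorem mem_himp {U V : RNLadder} {w : RNPoint} : w ∈ U ⇨ V ↔ ∀ v ≤ w, v ∈ U → v ∈ V := by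
  rw [← LowerSet.Iic_le, le_himp_iff]
  exact ⟨fun h v hv hU => h ⟨hv, hU⟩, fun h v hv => h v hv.1 hv.2⟩

theorem mem_compl {U : RNLadder} {w : RNPoint} : w ∈ (Uᶜ : RNLadder) ↔ ∀ v ≤ w, v ∉ U := by
  rw [← himp_bot, mem_himp]
  exact Iff.rfl

instance : Infinite RNLadder :=
  .of_injective LowerSet.Iic fun _ _ h => le_antisymm
    (LowerSet.Iic_le.1 h.le) (LowerSet.Iic_le.1 h.ge)

theorem finite_of_ne_top {U : RNLadder} (hU : U ≠ ⊤) : (U : Set RNPoint).Finite := by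
  obtain ⟨w, hw⟩ : ∃ w, w ∉ U := by
    by_contra! h
    exact hU (LowerSet.ext (Set.eq_univ_of_forall h))
  refine ((Set.finite_lt_nat (w.idx + 2)).preimage
    (f := RNPoint.idx) fun _ _ _ _ => RNPoint.ext).subset fun v hv => ?_
  by_contra h
  exact hw (U.lower (RNPoint.le_iff.2 (Or.inr (not_lt.1 h))) hv)

theorem eq_top_or_eq_top_of_sup_eq_top {U V : RNLadder} (h : U ⊔ V = ⊤) : U = ⊤ ∨ V = ⊤ := by
  by_contra! hUV
  refine Set.infinite_univ (α := RNPoint) ?_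
  rw [← LowerSet.coe_top, ← h, LowerSet.coe_sup]
  exact (finite_of_ne_top hUV.1).union (finite_of_ne_top hUV.2)

section lift

variable {H : Type u} [HeytingAlgebra H] {x a : H} {U V : RNLadder}

open Classical in
/-- The extension to the ladder of the map that sends its generator to `x`, as a function. -/
noncomputable def liftFun (x : H) (U : RNLadder) : H :=
  if h : U = ⊤ then ⊤ else (finite_of_ne_top h).toFinset.sup fun w => nishimura x w.idx

theorem liftFun_top : liftFun x ⊤ = ⊤ := dif_pos rfl

theorem nishimura_le_liftFun {w : RNPoint} (hw : w ∈ U) : nishimura x w.idx ≤ liftFun x U := by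
  unfold liftFun
  split_ifs with h
  · exact le_top
  · exact Finset.le_sup (f := fun w : RNPoint => nishimura x w.idx)
      ((finite_of_ne_top h).mem_toFinset.2 hw)

theorem liftFun_le (hU : U ≠ ⊤) (h : ∀ w ∈ U, nishimura x w.idx ≤ a) : liftFun x U ≤ a := by
  rw [liftFun, dif_neg hU]
  exact Finset.sup_le fun w hw => h w ((finite_of_ne_top hU).mem_toFinset.1 hw)

theorem liftFun_mono : Monotone (liftFun x) := fun U V h => by
  by_cases hV : V = ⊤
  · rw [hV, liftFun_top]
    exact le_top
  · exact liftFun_le (ne_top_of_le_ne_top hV h) fun w hw => nishimura_le_liftFun (h hw)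

theorem liftFun_Iic (w : RNPoint) : liftFun x (LowerSet.Iic w) = nishimura x w.idx := by
  have hne : LowerSet.Iic w ≠ ⊤ := fun h => by
    have : (⟨w.idx + 1⟩ : RNPoint) ∈ LowerSet.Iic w := h ▸ LowerSet.mem_top
    simp only [LowerSet.mem_Iic_iff, RNPoint.le_iff] at this
    omega
  exact (liftFun_le hne fun v hv => nishimura_idx_mono x hv).antisymm
    (nishimura_le_liftFun (LowerSet.mem_Iic_iff.2 le_rfl))

theorem nishimura_inf_nishimura_le_liftFun {v w : RNPoint} (hv : v ∈ U) (hw : w ∈ V) :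
    nishimura x v.idx ⊓ nishimura x w.idx ≤ liftFun x (U ⊓ V) := by
  have below {n : ℕ} (hn : ∀ k : RNPoint, k.idx + 2 ≤ n → k ∈ U ⊓ V) :
      nishimura x n ⊓ nishimura x (n + 1) ≤ liftFun x (U ⊓ V) :=
    nishimura_inf_succ_le fun k hk => nishimura_le_liftFun (w := ⟨k⟩) (hn ⟨k⟩ hk)
  by_cases hvw : v ≤ w
  · exact inf_le_left.trans (nishimura_le_liftFun ⟨hv, V.lower hvw hw⟩)
  by_cases hwv : w ≤ v
  · exact inf_le_right.trans (nishimura_le_liftFun ⟨U.lower hwv hv, hw⟩)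
  rw [RNPoint.le_iff] at hvw hwv
  obtain h | h : w.idx = v.idx + 1 ∨ v.idx = w.idx + 1 := by omega
  · rw [h]
    exact below fun k hk => ⟨U.lower (.inr hk) hv, V.lower (.inr (by omega)) hw⟩
  · rw [h, inf_comm]
    exact below fun k hk => ⟨U.lower (.inr (by omega)) hv, V.lower (.inr hk) hw⟩

theorem liftFun_inf (U V : RNLadder) : liftFun x (U ⊓ V) = liftFun x U ⊓ liftFun x V := by
  refine (liftFun_mono.map_inf_le U V).antisymm ?_
  by_cases hU : U = ⊤
  · rw [hU, top_inf_eq]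
    exact inf_le_right
  by_cases hV : V = ⊤
  · rw [hV, inf_top_eq]
    exact inf_le_left
  rw [← le_himp_iff]
  refine liftFun_le hU fun v hv => le_himp_comm.1 (liftFun_le hV fun w hw => le_himp_comm.1 ?_)
  exact le_himp_iff.2 (nishimura_inf_nishimura_le_liftFun hv hw)

theorem liftFun_sup (U V : RNLadder) : liftFun x (U ⊔ V) = liftFun x U ⊔ liftFun x V := by
  refine le_antisymm ?_ (liftFun_mono.le_map_sup U V)
  by_cases h : U ⊔ V = ⊤
  · obtain rfl | rfl := eq_top_or_eq_top_of_sup_eq_top h <;> simp [liftFun_top]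
  · refine liftFun_le h ?_
    rintro w (hw | hw)
    · exact (nishimura_le_liftFun hw).trans le_sup_left
    · exact (nishimura_le_liftFun hw).trans le_sup_right

theorem nishimura_himp_liftFun_le {n : ℕ} (hV : (⟨n⟩ : RNPoint) ∉ V) :
    nishimura x n ⇨ liftFun x V ≤ nishimura x (n + 1) := by
  rw [le_nishimura_succ_iff, inf_comm]
  have hne : LowerSet.Iic ⟨n⟩ ⊓ V ≠ ⊤ := fun h => hV ((inf_eq_top_iff.1 h).2 ▸ LowerSet.mem_top)
  calc nishimura x n ⊓ (nishimura x n ⇨ liftFun x V)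
      ≤ nishimura x n ⊓ liftFun x V := le_inf inf_le_left inf_himp_le
    _ = liftFun x (LowerSet.Iic ⟨n⟩ ⊓ V) := by rw [liftFun_inf, liftFun_Iic]
    _ ≤ _ := liftFun_le hne ?_
  rintro w ⟨h | h, hw⟩
  · exact absurd (RNPoint.ext h ▸ hw) hV
  · exact Finset.le_sup (f := fun k : Fin (n - 1) => nishimura x k)
      (Finset.mem_univ ⟨w.idx, by dsimp only at h; omega⟩)

theorem liftFun_himp (U V : RNLadder) : liftFun x (U ⇨ V) = liftFun x U ⇨ liftFun x V := by
  refine le_antisymm ?_ ?_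
  · rw [le_himp_iff, ← liftFun_inf]
    exact liftFun_mono himp_inf_le
  by_cases hUV : U ≤ V
  · rw [himp_eq_top_iff.2 hUV, liftFun_top]
    exact le_top
  classical
  have hex : ∃ n, (⟨n⟩ : RNPoint) ∈ U ∧ (⟨n⟩ : RNPoint) ∉ V :=
    let ⟨w, hw⟩ := Set.not_subset.1 hUV
    ⟨w.idx, hw⟩
  let n := Nat.find hex
  have hn : (⟨n⟩ : RNPoint) ∈ U ∧ (⟨n⟩ : RNPoint) ∉ V := Nat.find_spec hex
  have hle : liftFun x U ⇨ liftFun x V ≤ nishimura x (n + 1) :=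
    (himp_le_himp_right (nishimura_le_liftFun hn.1)).trans (nishimura_himp_liftFun_le hn.2)
  by_cases hmem : (⟨n + 1⟩ : RNPoint) ∈ U ⇨ V
  · exact hle.trans (nishimura_le_liftFun hmem)
  have hsucc : (⟨n + 1⟩ : RNPoint) ∈ U := by
    simp only [mem_himp, not_forall] at hmem
    obtain ⟨v, hv, hvU, hvV⟩ := hmem
    have : n ≤ v.idx := Nat.find_min' hex ⟨hvU, hvV⟩
    have := RNPoint.le_iff.1 hv
    exact U.lower (.inl (by dsimp only at this ⊢; omega)) hvU
  calc liftFun x U ⇨ liftFun x V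
      ≤ liftFun x U ⊓ (liftFun x U ⇨ liftFun x V) :=
        le_inf (hle.trans (nishimura_le_liftFun hsucc)) le_rfl
    _ ≤ liftFun x V := inf_himp_le
    _ ≤ liftFun x (U ⇨ V) := liftFun_mono le_himp

end lift

/-- The universal property of the ladder: the homomorphism that sends its generator to `x`. -/
noncomputable def lift {H : Type u} [HeytingAlgebra H] (x : H) : HeytingHom RNLadder H where
  toFun := liftFun x
  map_sup' := liftFun_sup
  map_inf' := liftFun_inf
  map_bot' := le_bot_iff.1 (liftFun_le bot_ne_top fun _ hw => hw.elim)
  map_himp' := liftFun_himp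

theorem lift_gen {H : Type u} [HeytingAlgebra H] (x : H) : lift x gen = x :=
  (liftFun_Iic ⟨0⟩).trans nishimura_zero

theorem nishimura_gen (n : ℕ) : nishimura gen n = LowerSet.Iic ⟨n⟩ := by
  induction n using Nat.strong_induction_on with
  | h n ih =>
    cases n with
    | zero => exact nishimura_zero
    | succ n =>
      have mem_sup {v : RNPoint} :
          v ∈ ((Finset.univ : Finset (Fin (n - 1))).sup fun k => nishimura gen k) ↔
            v.idx + 2 ≤ n := by
        have ih' (k : Fin (n - 1)) : nishimura gen k = LowerSet.Iic ⟨k⟩ := ih k (by omega)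
        simp only [Finset.sup_univ_eq_iSup, LowerSet.mem_iSup_iff, ih', LowerSet.mem_Iic_iff,
          RNPoint.le_iff]
        refine ⟨fun ⟨k, hk⟩ => by omega, fun h => ⟨⟨v.idx, by omega⟩, .inl rfl⟩⟩
      ext w
      rw [nishimura, ih n n.lt_succ_self]
      simp only [SetLike.mem_coe, mem_himp, mem_sup, LowerSet.mem_Iic_iff, RNPoint.le_iff]
      refine ⟨fun h => ?_, fun h v hv hvn => by omega⟩
      by_contra hw
      have := h ⟨n⟩ (by dsimp only; omega) (.inl rfl)
      dsimp only at this
      omega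

theorem lift_gen_apply (U : RNLadder) : lift gen U = U := by
  by_cases hU : U = ⊤
  · rw [hU, map_top]
  refine le_antisymm (liftFun_le hU fun w hw => ?_) fun w hw => LowerSet.Iic_le.1 ?_
  · rw [nishimura_gen]
    exact LowerSet.Iic_le.2 hw
  · rw [← nishimura_gen]
    exact nishimura_le_liftFun hw

theorem lift_mem {H : Type u} [HeytingAlgebra H] {x : H} {S : Set H} (hx : x ∈ S) (hbot : ⊥ ∈ S)
    (hsup : ∀ y ∈ S, ∀ z ∈ S, y ⊔ z ∈ S) (hhimp : ∀ y ∈ S, ∀ z ∈ S, y ⇨ z ∈ S) (U : RNLadder) :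
    lift x U ∈ S := by
  have nishimura_mem (n : ℕ) : nishimura x n ∈ S := by
    induction n using Nat.strong_induction_on with
    | h n ih =>
      cases n with
      | zero => rwa [nishimura_zero]
      | succ n =>
        rw [nishimura]
        exact hhimp _ (ih n n.lt_succ_self) _
          (Finset.sup_mem S hbot hsup _ _ fun k _ => ih k (by omega))
  by_cases hU : U = ⊤
  · rw [hU, map_top, ← himp_self (a := x)]
    exact hhimp x hx x hx
  · change liftFun x U ∈ S
    rw [liftFun, dif_neg hU]
    exact Finset.sup_mem S hbot hsup _ _ fun w _ => nishimura_mem w.idx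

theorem mem_of_closed {S : Set RNLadder} (hgen : gen ∈ S) (hbot : ⊥ ∈ S)
    (hsup : ∀ U ∈ S, ∀ V ∈ S, U ⊔ V ∈ S) (hhimp : ∀ U ∈ S, ∀ V ∈ S, U ⇨ V ∈ S) (U : RNLadder) :
    U ∈ S :=
  lift_gen_apply U ▸ lift_mem hgen hbot hsup hhimp U

end RNLadder

/-! ### The term `p¹⁰` and the defining formula -/

/-- The value of `p¹⁰` at `x`. -/
def heytingPow10 {H : Type u} [HeytingAlgebra H] (x : H) : H :=
  (xᶜᶜ ⇨ x) ⊔ ((xᶜᶜ ⇨ x) ⇨ (x ⊔ xᶜ))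

section heytingPow10

variable {H : Type u} [HeytingAlgebra H] {x : H}

theorem nishimura_one : nishimura x 1 = xᶜ := by
  simp [nishimura]

theorem nishimura_two : nishimura x 2 = xᶜᶜ := by
  rw [nishimura, nishimura_one]
  simp

theorem nishimura_three : nishimura x 3 = xᶜᶜ ⇨ x := by
  rw [nishimura, nishimura_two]
  simp [nishimura_zero]

theorem nishimura_four : nishimura x 4 = (xᶜᶜ ⇨ x) ⇨ (x ⊔ xᶜ) := by
  rw [nishimura, nishimura_three, show (Finset.univ : Finset (Fin (3 - 1))) = {0, 1} from rfl]
  simp [nishimura_zero, nishimura_one]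

theorem heytingPow10_eq_sup : heytingPow10 x = nishimura x 3 ⊔ nishimura x 4 := by
  rw [nishimura_three, nishimura_four, heytingPow10]

theorem heytingPow10_eq_top_of_le (h : xᶜᶜ ⇨ x ≤ x ⊔ xᶜ) : heytingPow10 x = ⊤ := by
  rw [heytingPow10, himp_eq_top_iff.2 h, sup_top_eq]

theorem heytingPow10_eq_top_of_isRegular (h : Heyting.IsRegular x) : heytingPow10 x = ⊤ := by
  rw [heytingPow10, h.eq, himp_self, top_sup_eq]

theorem heytingPow10_eq_top_of_compl_eq_bot (h : xᶜ = ⊥) : heytingPow10 x = ⊤ :=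
  heytingPow10_eq_top_of_le <| by simp [h]

theorem map_heytingPow10 {H' : Type v} [HeytingAlgebra H'] (f : HeytingHom H H') (x : H) :
    f (heytingPow10 x) = heytingPow10 (f x) := by
  simp only [heytingPow10, map_sup, map_himp, map_compl]

end heytingPow10

theorem eval_definingFormula {H : Type u} [HeytingAlgebra H] (p q : H) :
    definingFormula.eval ![p, q] = (p ⊓ q)ᶜ ⊓ ((qᶜᶜ ⇨ q) ⊓ (heytingPow10 p ⇨ (q ⊔ qᶜ))) :=
  rfl

namespace RNLadder

theorem mem_heytingPow10_gen {w : RNPoint} : w ∈ heytingPow10 gen ↔ w.idx ≤ 4 := by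
  simp only [heytingPow10_eq_sup, nishimura_gen, LowerSet.mem_sup_iff, LowerSet.mem_Iic_iff,
    RNPoint.le_iff]
  omega

theorem heytingPow10_gen_ne_top : heytingPow10 gen ≠ ⊤ := fun h => by
  have : (⟨5⟩ : RNPoint) ∈ heytingPow10 gen := h ▸ LowerSet.mem_top
  simp [mem_heytingPow10_gen] at this

theorem eq_one_of_zero_notMem {U : RNLadder} (h : ⟨0⟩ ∉ U) {w : RNPoint} (hw : w ∈ U) :
    w = ⟨1⟩ := by
  have hle : ¬ (⟨0⟩ : RNPoint) ≤ w := fun hle => h (U.lower hle hw)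
  simp only [RNPoint.le_iff] at hle
  exact RNPoint.ext (by dsimp only; omega)

theorem le_two_of_one_notMem {U : RNLadder} (h : ⟨1⟩ ∉ U) {w : RNPoint} (hw : w ∈ U) :
    w ≤ ⟨2⟩ := by
  have hle : ¬ (⟨1⟩ : RNPoint) ≤ w := fun hle => h (U.lower hle hw)
  simp only [RNPoint.le_iff] at hle ⊢
  omega

theorem mem_of_mem_compl_compl {U : RNLadder} {w : RNPoint} (hw : IsMin w) (h : w ∈ Uᶜᶜ) :
    w ∈ U := by
  by_contra hU
  exact mem_compl.1 h w le_rfl (mem_compl.2 fun v hv => hw.eq_of_le hv ▸ hU)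

theorem compl_eq_bot_of_mem {U : RNLadder} (h₀ : ⟨0⟩ ∈ U) (h₁ : ⟨1⟩ ∈ U) : Uᶜ = ⊥ := by
  have h₀' : (⟨0⟩ : RNPoint) ∉ Uᶜ := fun h => mem_compl.1 h _ le_rfl h₀
  refine eq_bot_iff.2 fun w hw => ?_
  obtain rfl := eq_one_of_zero_notMem h₀' hw
  exact absurd h₁ (mem_compl.1 hw _ le_rfl)

theorem eq_gen_or_isRegular_or_compl_eq_bot (U : RNLadder) :
    U = gen ∨ Heyting.IsRegular U ∨ Uᶜ = ⊥ := by
  by_cases h₀ : ⟨0⟩ ∈ U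
  · by_cases h₁ : ⟨1⟩ ∈ U
    · exact .inr (.inr (compl_eq_bot_of_mem h₀ h₁))
    by_cases h₂ : ⟨2⟩ ∈ U
    · have h₁' : ⟨1⟩ ∉ Uᶜᶜ := mt (mem_of_mem_compl_compl RNPoint.isMin_one) h₁
      exact .inr (.inl (le_compl_compl.antisymm'
        fun w hw => U.lower (le_two_of_one_notMem h₁' hw) h₂))
    · refine .inl (le_antisymm (fun w hw => ?_) (LowerSet.Iic_le.2 h₀))
      obtain h | h := RNPoint.le_iff.1 (le_two_of_one_notMem h₁ hw)
      · exact absurd (RNPoint.ext h ▸ hw) h₂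
      · exact LowerSet.mem_Iic_iff.2 (.inl (Nat.le_zero.1 (Nat.le_of_add_le_add_right h)))
  · have h₀' : ⟨0⟩ ∉ Uᶜᶜ := mt (mem_of_mem_compl_compl RNPoint.isMin_zero) h₀
    refine .inr (.inl (le_compl_compl.antisymm' fun w hw => ?_))
    obtain rfl := eq_one_of_zero_notMem h₀' hw
    exact mem_of_mem_compl_compl RNPoint.isMin_one hw

theorem eq_gen_of_heytingPow10_ne_top {U : RNLadder} (h : heytingPow10 U ≠ ⊤) : U = gen :=
  (eq_gen_or_isRegular_or_compl_eq_bot U).resolve_right fun h' =>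
    h (h'.elim heytingPow10_eq_top_of_isRegular heytingPow10_eq_top_of_compl_eq_bot)

theorem eval_definingFormula_le (p q : RNLadder) : definingFormula.eval ![p, q] ≤ q ⊔ qᶜ := by
  rw [eval_definingFormula]
  by_cases hp : heytingPow10 p = ⊤
  · rw [hp, top_himp]
    exact inf_le_right.trans inf_le_right
  obtain rfl := eq_gen_of_heytingPow10_ne_top hp
  refine (inf_le_inf_left _ inf_le_right).trans fun w ⟨hdisj, himp⟩ => ?_
  rw [SetLike.mem_coe, mem_compl] at hdisj
  rw [SetLike.mem_coe, mem_himp] at himp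
  -- Disjointness makes `w₁` the only point of `q` below `w`, so `w₃` is in neither `q` nor `qᶜ`.
  by_contra hw
  obtain ⟨v, hvw, hvq⟩ : ∃ v ≤ w, v ∈ q := by
    by_contra! h
    exact hw (.inr (mem_compl.2 h))
  have zero_notMem {u : RNPoint} (hu : u ≤ w) (huq : u ∈ q) : ⟨0⟩ ∉ LowerSet.Iic u := fun h =>
    hdisj _ (h.trans hu) ⟨LowerSet.mem_Iic_iff.2 le_rfl, q.lower h huq⟩
  obtain rfl := eq_one_of_zero_notMem (zero_notMem hvw hvq) (LowerSet.mem_Iic_iff.2 le_rfl)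
  have hw_pow : ¬ w.idx ≤ 4 := fun h => hw (himp w le_rfl (mem_heytingPow10_gen.2 h))
  have h₃ : (⟨3⟩ : RNPoint) ≤ w := .inr (by dsimp only; omega)
  obtain h | h := himp ⟨3⟩ h₃ (mem_heytingPow10_gen.2 (by dsimp only; omega))
  · exact zero_notMem h₃ h (.inr (by dsimp only; omega))
  · exact mem_compl.1 h ⟨1⟩ (.inr (by dsimp only; omega)) hvq

end RNLadder

/-! ### Homomorphisms between concatenations -/

/-- The unique homomorphism from the two-element Boolean algebra to a Heyting algebra. -/
def boolHom (H : Type u) [HeytingAlgebra H] : HeytingHom Bool H where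
  toFun b := bif b then ⊤ else ⊥
  map_sup' x y := by cases x <;> cases y <;> simp
  map_inf' x y := by cases x <;> cases y <;> simp
  map_bot' := rfl
  map_himp' x y := by cases x <;> cases y <;> simp [himp_eq]

theorem boolHom_injective (H : Type u) [HeytingAlgebra H] [Nontrivial H] :
    Function.Injective (boolHom H) := by
  rw [Bool.injective_iff]
  exact bot_ne_top (α := H)

/-- The first projection of a product of Heyting algebras. -/
def prodFstHom (A : Type u) (B : Type v) [HeytingAlgebra A] [HeytingAlgebra B] :
    HeytingHom (A × B) A where
  toFun := Prod.fst
  map_sup' _ _ := rfl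
  map_inf' _ _ := rfl
  map_bot' := rfl
  map_himp' _ _ := rfl

/-- The second projection of a product of Heyting algebras. -/
def prodSndHom (A : Type u) (B : Type v) [HeytingAlgebra A] [HeytingAlgebra B] :
    HeytingHom (A × B) B where
  toFun := Prod.snd
  map_sup' _ _ := rfl
  map_inf' _ _ := rfl
  map_bot' := rfl
  map_himp' _ _ := rfl

namespace Concat

section

variable {A : Type u} {B : Type v} [HeytingAlgebra A] [HeytingAlgebra B]

/-- The projection of a concatenation onto its lower part, which collapses the upper part. -/
noncomputable def fstHom (A : Type u) (B : Type v) [HeytingAlgebra A] [HeytingAlgebra B] :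
    HeytingHom (Concat A B) A where
  toFun := Concat.fst
  map_sup' _ _ := rfl
  map_inf' _ _ := rfl
  map_bot' := rfl
  map_himp' _ _ := rfl

theorem fst_sup (x y : Concat A B) : (x ⊔ y).fst = x.fst ⊔ y.fst := rfl

theorem fst_himp (x y : Concat A B) : (x ⇨ y).fst = x.fst ⇨ y.fst := rfl

theorem fst_compl (x : Concat A B) : (xᶜ).fst = (x.fst)ᶜ := map_compl (fstHom A B) x

theorem le_of_fst_le {x y : Concat A B} (h : x.fst ≠ ⊤) (hle : x.fst ≤ y.fst) : x ≤ y :=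
  ⟨hle, (x.glued.resolve_left h).trans_le bot_le⟩

theorem eq_of_fst_eq {x y : Concat A B} (h : x.fst ≠ ⊤) (he : x.fst = y.fst) : x = y :=
  (le_of_fst_le h he.le).antisymm (le_of_fst_le (he ▸ h) he.ge)

theorem inl_injective : Function.Injective (inl : A → Concat A B) := fun _ _ h =>
  congrArg Concat.fst h

theorem isRegular_of_isRegular_fst {x : Concat A B} (hx : x.fst ≠ ⊤)
    (h : Heyting.IsRegular x.fst) : Heyting.IsRegular x :=
  (eq_of_fst_eq hx <| by rw [fst_compl, fst_compl, h.eq]).symm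

theorem heytingPow10_eq_top_of_fst [Nontrivial A] {x : Concat A B}
    (h : Heyting.IsRegular x.fst ∨ x.fstᶜᶜ ⇨ x.fst ≤ x.fst ⊔ x.fstᶜ) : heytingPow10 x = ⊤ := by
  by_cases hx : x.fst = ⊤
  · have hfst : (xᶜ).fst = ⊥ := by rw [fst_compl, hx, compl_top]
    exact heytingPow10_eq_top_of_compl_eq_bot (eq_of_fst_eq (hfst.trans_ne bot_ne_top) hfst)
  by_cases hreg : Heyting.IsRegular x.fst
  · exact heytingPow10_eq_top_of_isRegular (isRegular_of_isRegular_fst hx hreg)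
  · refine heytingPow10_eq_top_of_le (le_of_fst_le ?_ ?_)
    · rw [fst_himp, fst_compl, fst_compl, Ne, himp_eq_top_iff]
      exact fun hle => hreg (hle.antisymm le_compl_compl)
    · rw [fst_himp, fst_sup, fst_compl, fst_compl]
      exact h.resolve_left hreg

theorem isGreatest_inr_false : IsGreatest {x : Concat A Bool | x ≠ ⊤} (inr false) := by
  refine ⟨fun h => Bool.false_ne_true (congrArg Concat.snd h), fun x hx => ⟨le_top, ?_⟩⟩
  rcases x.glued with h | h
  · exact (Bool.of_not_eq_true fun h' => hx (Concat.ext h h')).le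
  · exact h.le

end

section map

variable {A B C : Type*} [HeytingAlgebra A] [HeytingAlgebra B] [HeytingAlgebra C]

open Classical in
/-- A homomorphism of the upper parts extends to concatenations. -/
noncomputable def map (f : HeytingHom B C) : HeytingHom (Concat A B) (Concat A C) where
  toFun x := ⟨x.fst, f x.snd, x.glued.imp_right fun h => by rw [h, map_bot]⟩
  map_sup' x y := Concat.ext rfl (map_sup f _ _)
  map_inf' x y := Concat.ext rfl (map_inf f _ _)
  map_bot' := Concat.ext rfl (map_bot f)
  map_himp' x y := by
    refine Concat.ext rfl ?_
    change f (if x.fst ≤ y.fst then x.snd ⇨ y.snd else ⊥) =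
      if x.fst ≤ y.fst then f x.snd ⇨ f y.snd else ⊥
    split_ifs
    · exact map_himp f _ _
    · exact map_bot f

theorem map_injective {f : HeytingHom B C} (hf : Function.Injective f) :
    Function.Injective (map (A := A) f) := fun _ _ h =>
  Concat.ext (congrArg (·.fst) h) (hf (congrArg (·.snd) h))

theorem map_inl (f : HeytingHom B C) (x : A) : map f (inl x) = inl x :=
  Concat.ext rfl (map_bot f)

end map

end Concat

/-! ### The defining formula over `Z × Z₂ + A` -/

theorem Concat.eq_gen_of_heytingPow10_ne_top {A : Type u} {B : Type v} [HeytingAlgebra A]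
    [BooleanAlgebra B] {x : Concat (RNLadder × B) A} (h : heytingPow10 x ≠ ⊤) :
    x.fst.1 = RNLadder.gen := by
  refine (RNLadder.eq_gen_or_isRegular_or_compl_eq_bot x.fst.1).resolve_right fun h' => ?_
  refine h (Concat.heytingPow10_eq_top_of_fst (h'.imp (fun hreg => ?_) fun hbot => ⟨?_, ?_⟩))
  · exact Prod.ext hreg (compl_compl x.fst.2)
  · change x.fst.1ᶜᶜ ⇨ x.fst.1 ≤ x.fst.1 ⊔ x.fst.1ᶜ
    simp [hbot]
  · exact le_top.trans_eq (sup_compl_eq_top (x := x.fst.2)).symm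

theorem fst_eval_definingFormula_le {A : Type u} {B : Type v} [HeytingAlgebra A] [BooleanAlgebra B]
    (p q : Concat (RNLadder × B) A) :
    (definingFormula.eval ![p, q]).fst ≤ (q ⊔ qᶜ).fst := by
  have hZ := definingFormula.eval_comp_pair ((prodFstHom RNLadder B).comp (Concat.fstHom _ A)) p q
  rw [Concat.fst_sup, Concat.fst_compl]
  exact ⟨hZ.symm.trans_le (RNLadder.eval_definingFormula_le _ _),
    le_top.trans_eq (sup_compl_eq_top (x := q.fst.2)).symm⟩

section

variable {A : Type u} [HeytingAlgebra A]

theorem eval_definingFormula_le_or_eq (p q : Concat (RNLadder × Bool) A) :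
    definingFormula.eval ![p, q] ≤ q ⊔ qᶜ ∨
      p = Concat.inl (RNLadder.gen, false) ∧ q = Concat.inl (⊥, true) := by
  by_cases hle : definingFormula.eval ![p, q] ≤ q ⊔ qᶜ
  · exact .inl hle
  have hfst := fst_eval_definingFormula_le p q
  have he : (definingFormula.eval ![p, q]).fst = ⊤ := by
    by_contra he
    exact hle (Concat.le_of_fst_le he hfst)
  rw [he, top_le_iff, Concat.fst_sup, Concat.fst_compl] at hfst
  have hp : p.fst.1 = RNLadder.gen := Concat.eq_gen_of_heytingPow10_ne_top fun h => hle <| by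
    rw [eval_definingFormula, h, top_himp]
    exact inf_le_right.trans inf_le_right
  have hpq : p.fst ⊓ q.fst = ⊥ := by
    have : (definingFormula.eval ![p, q]).fst ≤ ((p ⊓ q)ᶜ).fst := (inf_le_left : _ ≤ (p ⊓ q)ᶜ).1
    rwa [he, Concat.fst_compl, le_compl_iff_disjoint_right, top_disjoint] at this
  have hq : q.fst.1 = ⊥ := by
    obtain h | h := RNLadder.eq_top_or_eq_top_of_sup_eq_top (congrArg Prod.fst hfst)
    · have hgen : p.fst.1 ⊓ q.fst.1 = ⊥ := congrArg Prod.fst hpq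
      rw [hp, h, inf_top_eq] at hgen
      exact absurd hgen (LowerSet.Iic_ne_bot)
    · exact top_disjoint.1 (le_compl_iff_disjoint_right.1 (h.ge : ⊤ ≤ q.fst.1ᶜ))
  have hq_ne : q.fst ≠ ⊤ := fun h => bot_ne_top (hq.symm.trans (congrArg Prod.fst h))
  cases hq₂ : q.fst.2 with
  | false =>
    obtain rfl : q = ⊥ := Concat.eq_of_fst_eq hq_ne (Prod.ext hq hq₂)
    rw [compl_bot, sup_top_eq] at hle
    exact absurd le_top hle
  | true =>
    have hp₂ : p.fst.2 = false := by
      have : (p.fst.2 && q.fst.2) = false := congrArg Prod.snd hpq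
      rwa [hq₂, Bool.and_true] at this
    have hp_ne : p.fst ≠ ⊤ := fun h =>
      Bool.false_ne_true (hp₂.symm.trans (congrArg Prod.snd h))
    exact .inr ⟨Concat.eq_of_fst_eq hp_ne (Prod.ext hp hp₂),
      Concat.eq_of_fst_eq hq_ne (Prod.ext hq hq₂)⟩

variable {ψ : Formula (Fin 2)}

theorem le_eval_of_le_sup_compl {H : Type u} [HeytingAlgebra H]
    (hψ : ψ.eval ![ZPrime.a, ZPrime.b] = ⊤) {e p q : H}
    (hpq : e ≤ (p ⊓ q)ᶜ) (hq : e ≤ q ⊔ qᶜ) : e ≤ ψ.eval ![p, q] := by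
  have eval_bot_top : ψ.eval ![(⊥ : H), ⊤] = ⊤ := by
    have := ψ.eval_comp_pair ((boolHom H).comp
      ((prodSndHom RNLadder Bool).comp (Concat.fstHom _ Bool))) ZPrime.a ZPrime.b
    rwa [hψ, map_top] at this
  have eval_bot : ψ.eval ![p, ⊥] = ⊤ := by
    have : ψ.eval ![RNLadder.lift p RNLadder.gen, RNLadder.lift p ⊥] = _ :=
      ψ.eval_comp_pair ((RNLadder.lift p).comp
        ((prodFstHom RNLadder Bool).comp (Concat.fstHom _ Bool))) ZPrime.a ZPrime.b
    rwa [hψ, map_top, RNLadder.lift_gen, map_bot] at this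
  have hinf : e ⊓ q ≤ ψ.eval ![p, q] := by
    have h₀ : e ⊓ q ⊓ p = e ⊓ q ⊓ ⊥ := by
      rw [inf_bot_eq, inf_assoc, inf_comm q p]
      exact (le_compl_iff_disjoint_right.1 hpq).eq_bot
    have h₁ : e ⊓ q ⊓ q = e ⊓ q ⊓ ⊤ := by rw [inf_right_idem, inf_top_eq]
    exact le_eval_of_forall_inf_eq (μ := ![⊥, ⊤]) (Fin.forall_fin_two.2 ⟨h₀, h₁⟩) eval_bot_top
  have hinf_compl : e ⊓ qᶜ ≤ ψ.eval ![p, q] := by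
    have h₁ : e ⊓ qᶜ ⊓ q = e ⊓ qᶜ ⊓ ⊥ := by rw [inf_assoc, compl_inf_self, inf_bot_eq, inf_bot_eq]
    exact le_eval_of_forall_inf_eq (μ := ![p, ⊥]) (Fin.forall_fin_two.2 ⟨rfl, h₁⟩) eval_bot
  calc e = e ⊓ (q ⊔ qᶜ) := (inf_eq_left.2 hq).symm
    _ = e ⊓ q ⊔ e ⊓ qᶜ := inf_sup_left _ _ _
    _ ≤ ψ.eval ![p, q] := sup_le hinf hinf_compl

theorem eval_definingFormula_le (hψ : ψ.eval ![ZPrime.a, ZPrime.b] = ⊤)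
    (p q : Concat (RNLadder × Bool) A) : definingFormula.eval ![p, q] ≤ ψ.eval ![p, q] := by
  rcases eval_definingFormula_le_or_eq p q with hle | ⟨rfl, rfl⟩
  · exact le_eval_of_le_sup_compl hψ inf_le_left hle
  · rw [← Concat.map_inl (boolHom A), ← Concat.map_inl (boolHom A), ψ.eval_comp_pair]
    change _ ≤ Concat.map (boolHom A) (ψ.eval ![ZPrime.a, ZPrime.b])
    rw [hψ, map_top]
    exact le_top

end

/-! ### The algebra `Z'` -/

namespace ZPrime

instance : Infinite ZPrime := .of_injective Concat.inl Concat.inl_injective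

theorem compl_b : bᶜ = Concat.inl (⊤, false) := by
  have h : (bᶜ).fst = (⊤, false) := by
    rw [Concat.fst_compl]
    exact Prod.ext compl_bot rfl
  refine Concat.eq_of_fst_eq ?_ h
  rw [h]
  exact fun h' => Bool.false_ne_true (congrArg Prod.snd h')

theorem inl_himp_inf_compl_b (U V : RNLadder) :
    (Concat.inl (U, false) ⇨ Concat.inl (V, false)) ⊓ bᶜ =
      (Concat.inl (U ⇨ V, false) : ZPrime) := by
  rw [compl_b]
  exact Concat.ext (Prod.ext (inf_top_eq _) (inf_bot_eq _)) (inf_bot_eq _)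

theorem inf_a_b : a ⊓ b = ⊥ :=
  Concat.ext (Prod.ext (inf_bot_eq _) rfl) rfl

theorem generates : Generates ![a, b] := by
  intro S hS hinf hsup himp hcompl
  have ha : a ∈ S := hS 0
  have hb : b ∈ S := hS 1
  have hfalse : ∀ U, (Concat.inl (U, false) : ZPrime) ∈ S := by
    refine RNLadder.mem_of_closed (S := {U | (Concat.inl (U, false) : ZPrime) ∈ S}) ha
      (inf_a_b ▸ hinf _ ha _ hb :) (fun U hU V hV => ?_) (fun U hU V hV => ?_)
    · have h : (Concat.inl (U, false) ⊔ Concat.inl (V, false) : ZPrime) =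
          Concat.inl (U ⊔ V, false) := Concat.ext rfl rfl
      exact (h ▸ hsup _ hU _ hV :)
    · exact (inl_himp_inf_compl_b U V ▸ hinf _ (himp _ hU _ hV) _ (hcompl _ hb) :)
  have hinl : ∀ x, (Concat.inl x : ZPrime) ∈ S := by
    rintro ⟨U, _ | _⟩
    · exact hfalse U
    · have h : (Concat.inl (U, false) ⊔ b : ZPrime) = Concat.inl (U, true) :=
        Concat.ext (Prod.ext (sup_bot_eq U) rfl) rfl
      exact h ▸ hsup _ (hfalse U) _ hb
  refine Set.eq_univ_of_forall fun x => ?_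
  by_cases hx : x = ⊤
  · rw [hx, ← himp_self (a := a)]
    exact himp _ ha _ ha
  · have h : x = Concat.inl x.fst :=
      Concat.ext rfl (le_bot_iff.1 (Concat.isGreatest_inr_false.2 hx).2)
    exact h ▸ hinl x.fst

theorem sup_compl_b : b ⊔ bᶜ = Concat.inr false := by
  rw [compl_b]
  exact Concat.ext (Prod.ext (bot_sup_eq _) rfl) rfl

theorem isRegular_b : Heyting.IsRegular b :=
  Concat.isRegular_of_isRegular_fst
    (fun h => bot_ne_top (α := RNLadder) (congrArg Prod.fst h))
    (Prod.ext Heyting.isRegular_bot rfl)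

theorem heytingPow10_a_ne_top : heytingPow10 a ≠ ⊤ := fun h =>
  RNLadder.heytingPow10_gen_ne_top <| by
    have := map_heytingPow10 ((prodFstHom RNLadder Bool).comp (Concat.fstHom _ Bool)) a
    rw [h, map_top] at this
    exact this.symm

theorem eval_definingFormula_eq_top : definingFormula.eval ![a, b] = ⊤ := by
  have hpow : heytingPow10 a ≤ b ⊔ bᶜ :=
    sup_compl_b ▸ Concat.isGreatest_inr_false.2 heytingPow10_a_ne_top
  rw [eval_definingFormula, inf_a_b, compl_bot, isRegular_b.eq, himp_self,
    himp_eq_top_iff.2 hpow, inf_top_eq, inf_top_eq]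

theorem definesOver (A : Type u) [HeytingAlgebra A] :
    DefinesOver (generatedVariety (Concat (RNLadder × Bool) A)) definingFormula ![a, b] where
  generates := generates
  holds := eval_definingFormula_eq_top
  consequence ψ hψ := validIn_generatedVariety fun μ => himp_eq_top_iff.2 <| by
    have hμ : μ = ![μ 0, μ 1] := List.ofFn_inj.mp rfl
    rw [hμ]
    exact eval_definingFormula_le hψ _ _

end ZPrime

theorem theorem4p1 (A : Type u) [HeytingAlgebra A] [Nontrivial A] :
    Infinite ZPrime ∧ SubdirectlyIrreducible ZPrime ∧
    ContainsCopy (generatedVariety (Concat (RNLadder × Bool) A)) ZPrime ∧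
    DefinesOver (generatedVariety (Concat (RNLadder × Bool) A)) definingFormula
      ![ZPrime.a, ZPrime.b] ∧
    FinitelyPresentableOver (generatedVariety (Concat (RNLadder × Bool) A)) ZPrime :=
  ⟨inferInstance, subdirectlyIrreducible_of_isGreatest Concat.isGreatest_inr_false,
    containsCopy_generatedVariety _ (Concat.map_injective (boolHom_injective A)),
    ZPrime.definesOver A, _, _, _, ZPrime.definesOver A⟩
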